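/- Let $n\ge 2$ and let $Q_n=\langle x,y : x^{2n}=1,\ x^n=y^2,\ y^{-1}xy=x^{-1}\rangle$ be the dicyclic group of order $4n$. Let $\Gamma(Q_n)$ be its generating graph, whose vertices are the elements of $Q_n$, two distinct elements being adjacent if and only if together they generate $Q_n$, and let $A(Q_n)$ be the adjacency matrix of $\Gamma(Q_n)$. Let $n_0$ be the squarefree part of $n$, that is, the product of the distinct primes dividing $n$, and let $1=d_1<d_2<\dots<d_{2^k}=n_0$ be the positive divisors of $n_0$, where $k$ is the number of distinct prime divisors of $n$. Then the spectrum of $A(Q_n)$, as the multiset of its $4n$ eigenvalues counted with multiplicity, is $$\mathrm{Spec}_{A(Q_n)}=\begin{pmatrix} 0&2\mu(d_2)\frac{\varphi(n)}{\varphi(d_2)}&2\mu(d_3)\frac{\varphi(n)}{\varphi(d_3)}&\dots&2\mu(d_{2^k})\frac{\varphi(n)}{\varphi(d_{2^k})}&\lambda_1&\lambda_2\\ 4n-(n_0+1)&\varphi(d_2)&\varphi(d_3)&\dots&\varphi(d_{2^k})&1&1 \end{pmatrix},$$ where $$\lambda_1=\varphi(n)+\sqrt{\varphi(n)^2+4n\varphi(n)},\qquad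 \lambda_2=\varphi(n)-\sqrt{\varphi(n)^2+4n\varphi(n)},$$ $\mu$ is the Möbius function and $\varphi$ is Euler's totient function. Here the second row gives the number of times that each column contributes its entry in the first row to the multiset; if the same number occurs in several columns, its multiplicity as an eigenvalue is the sum of the corresponding entries of the second row. -/

import Mathlib

/-- The generating graph of a group `G`: its vertices are the elements of `G`, and two distinct
elements are adjacent when together they generate `G`. -/
def generatingGraph (G : Type*) [Group G] : SimpleGraph G where
  Adj g h := g ≠ h ∧ Subgroup.closure {g, h} = ⊤
  symm := ⟨fun g h hgh => ⟨hgh.1.symm, by rw [Set.pair_comm]; exact hgh.2⟩⟩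
  loopless := ⟨fun _ h => h.1 rfl⟩

/-- The squarefree part `n₀` of `n`, in the sense of the product of the distinct primes
dividing `n`. -/
def squarefreePart (n : ℕ) : ℕ := ∏ p ∈ n.primeFactors, p

/-- The adjacency spectrum of a finite graph: the multiset of the eigenvalues of its (real
symmetric) adjacency matrix, each repeated according to its multiplicity. -/
noncomputable def adjacencySpectrum {V : Type*} [Fintype V] [DecidableEq V] (X : SimpleGraph V)
    [DecidableRel X.Adj] : Multiset ℝ :=
  (X.adjMatrix ℝ).charpoly.roots

/-! Let `f` be the indicator on `ZMod (2 * n)` of the residues that are units mod `n`. Two elements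
`a i`, `a j` lie in a proper cyclic subgroup; `a i`, `xa j` generate iff `f i = 1`, and `xa i`, `xa
j` iff `f (i - j) = 1`. The adjacency matrix thus has blocks `0`, `f i`, `f j` and the circulant of
`f`.

Eliminating the zero block by a Schur complement changes the circulant only by a constant matrix, so
additive characters still diagonalise it and only the trivial one sees the change. With N = 2n, the
characteristic polynomial is X^(N-1) (X² - (∑ f) X - N ∑ f²) times the product of X - f̂(k) over k ≠
0 (`charpoly_fromBlocks_circulant`). Since ∑ f = ∑ f² = 2φ(n), the quadratic has roots λ₁, λ₂. Each
f̂(k) is a Ramanujan sum depending only on the order d of k (`sum_isUnit_cast_mul_stdAddChar`): it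
vanishes unless d is a squarefree divisor of n, that is, a divisor of n₀, and each such d occurs for
φ(d) residues k. -/

/-! ### Circulants and the block characteristic polynomial -/

/-- The determinant of a circulant matrix over `ZMod N` is the product of the values of the
discrete Fourier transform of its first column. -/
theorem Matrix.det_circulant_zmod {N : ℕ} [NeZero N] (v : ZMod N → ℂ) :
    (Matrix.circulant v).det = ∏ k, ∑ i, v i * ZMod.stdAddChar (i * k) := by
  let F : Matrix (ZMod N) (ZMod N) ℂ := Matrix.of fun i k => ZMod.stdAddChar (-(i * k))
  let F' : Matrix (ZMod N) (ZMod N) ℂ := Matrix.of fun i k => ZMod.stdAddChar (i * k)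
  have hF : F * F' = (N : ℂ) • (1 : Matrix (ZMod N) (ZMod N) ℂ) := by
    ext i j
    simp only [F, F', Matrix.mul_apply, Matrix.of_apply, ← AddChar.map_add_eq_mul,
      Matrix.smul_apply, Matrix.one_apply, smul_eq_mul]
    have h := AddChar.sum_mulShift (R' := ℂ) (j - i) (ZMod.isPrimitive_stdAddChar N)
    rw [ZMod.card] at h
    rw [show (∑ x, ZMod.stdAddChar (-(i * x) + x * j) : ℂ)
      = ∑ x, ZMod.stdAddChar (x * (j - i)) from
        Finset.sum_congr rfl fun x _ => by congr 1; ring, h]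
    by_cases hij : i = j
    · simp [hij]
    · simp [hij, sub_ne_zero.2 (Ne.symm hij)]
  have hdet : F.det ≠ 0 := by
    intro h0
    have h := congrArg Matrix.det hF
    rw [Matrix.det_mul, h0, zero_mul, Matrix.det_smul, Matrix.det_one, mul_one] at h
    exact pow_ne_zero _ (Nat.cast_ne_zero.2 (NeZero.ne N)) h.symm
  -- The columns of `F` are characters, hence eigenvectors of every circulant.
  have hmul : Matrix.circulant v * F
      = F * Matrix.diagonal fun k => ∑ i, v i * ZMod.stdAddChar (i * k) := by
    ext i k
    rw [Matrix.mul_diagonal, Matrix.mul_apply, Finset.mul_sum]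
    refine Fintype.sum_equiv (Equiv.subLeft i) _ _ fun j => ?_
    simp only [Matrix.circulant_apply, F, Matrix.of_apply, Equiv.subLeft_apply]
    rw [mul_left_comm, ← AddChar.map_add_eq_mul]
    congr 2
    ring
  have h := congrArg Matrix.det hmul
  rw [Matrix.det_mul, Matrix.det_mul, Matrix.det_diagonal, mul_comm] at h
  exact mul_left_cancel₀ hdet h

/-- Schur complement of the block x·1, invertible as x ≠ 0. The correction is the constant matrix
s/x, whose transform is supported at k = 0. -/
theorem eval_charpoly_fromBlocks_circulant {N : ℕ} [NeZero N] (f : ZMod N → ℂ) {x : ℂ}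
    (hx : x ≠ 0) :
    (Matrix.fromBlocks 0 (Matrix.of fun i _ => f i) (Matrix.of fun _ j => f j)
      (Matrix.circulant f)).charpoly.eval x =
    x ^ N * ∏ k, (x - (∑ i, f i * ZMod.stdAddChar (i * k))
      - if k = 0 then N * (∑ i, f i ^ 2) / x else 0) := by
  set s := ∑ i, f i ^ 2 with hs
  have hinv : (Matrix.scalar (ZMod N) x) * (Matrix.scalar (ZMod N) x⁻¹) = 1 := by
    rw [← map_mul, mul_inv_cancel₀ hx, map_one]
  let hI : Invertible (Matrix.scalar (ZMod N) x) :=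
    ⟨Matrix.scalar (ZMod N) x⁻¹, by rw [← map_mul, inv_mul_cancel₀ hx, map_one], hinv⟩
  have hinv' : ⅟(Matrix.scalar (ZMod N) x) = Matrix.scalar (ZMod N) x⁻¹ := rfl
  have hsub : Matrix.scalar (ZMod N ⊕ ZMod N) x
      - Matrix.fromBlocks 0 (Matrix.of fun i _ => f i) (Matrix.of fun _ j => f j)
        (Matrix.circulant f)
      = Matrix.fromBlocks (Matrix.scalar (ZMod N) x) (0 - Matrix.of fun i _ => f i)
        (0 - Matrix.of fun _ j => f j) (Matrix.scalar (ZMod N) x - Matrix.circulant f) := by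
    ext (i | i) (j | j) <;> simp [Matrix.scalar_apply, Matrix.diagonal_apply]
  rw [Matrix.eval_charpoly, hsub, Matrix.det_fromBlocks₁₁, hinv']
  congr 1
  · simp [Matrix.scalar_apply]
  have hcirc : Matrix.scalar (ZMod N) x - Matrix.circulant f
      - (0 - Matrix.of fun _ j => f j) * Matrix.scalar (ZMod N) x⁻¹
        * (0 - Matrix.of fun i _ => f i)
      = Matrix.circulant fun m => (if m = 0 then x else 0) - f m - s / x := by
    ext i j
    simp only [Matrix.sub_apply, Matrix.scalar_apply, Matrix.diagonal_apply,
      Matrix.circulant_apply, Matrix.mul_apply, sub_eq_zero, Matrix.of_apply, Matrix.zero_apply]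
    rw [hs, Finset.sum_div]
    congr 1
    refine Finset.sum_congr rfl fun k _ => ?_
    simp only [mul_ite, mul_zero, Finset.sum_ite_eq', Finset.mem_univ, if_true]
    ring
  rw [hcirc, Matrix.det_circulant_zmod]
  refine Finset.prod_congr rfl fun k _ => ?_
  have h := AddChar.sum_mulShift (R' := ℂ) k (ZMod.isPrimitive_stdAddChar N)
  rw [ZMod.card] at h
  simp only [sub_mul, Finset.sum_sub_distrib, ← Finset.mul_sum, h, ite_mul, zero_mul,
    Finset.sum_ite_eq', Finset.mem_univ, if_true, AddChar.map_zero_eq_one,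
    mul_one]
  split_ifs <;> ring

-- The two polynomials agree at every nonzero x. One of the N factors x clears the denominator at k
-- = 0 and produces the quadratic.
open Polynomial in
theorem charpoly_fromBlocks_circulant {N : ℕ} [NeZero N] (f : ZMod N → ℂ) :
    (Matrix.fromBlocks 0 (Matrix.of fun i _ => f i) (Matrix.of fun _ j => f j)
      (Matrix.circulant f)).charpoly =
    X ^ (N - 1) * (X ^ 2 - C (∑ i, f i) * X - C (N * ∑ i, f i ^ 2))
      * ∏ k ∈ Finset.univ.erase 0, (X - C (∑ i, f i * ZMod.stdAddChar (i * k))) := by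
  refine Polynomial.eq_of_infinite_eval_eq _ _
    ((Set.finite_singleton (0 : ℂ)).infinite_compl.mono fun x hx => ?_)
  have hx : x ≠ 0 := hx
  rw [Set.mem_ofPred_eq, eval_charpoly_fromBlocks_circulant f hx,
    ← Finset.mul_prod_erase _ _ (Finset.mem_univ (0 : ZMod N))]
  simp only [eval_mul, eval_pow, eval_X, eval_sub, eval_C, eval_prod, if_true, mul_zero,
    AddChar.map_zero_eq_one, mul_one]
  rw [← mul_assoc]
  congr 1
  · rw [← pow_sub_one_mul (NeZero.ne N) x, mul_assoc]
    field_simp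
  · refine Finset.prod_congr rfl fun k hk => ?_
    rw [if_neg (Finset.ne_of_mem_erase hk), sub_zero]

/-! ### Ramanujan sums -/

/-- Sum h(f(g)·y) over all pairs (g, y) in both orders: translation invariance evaluates each inner
sum, with no need to count fibres. -/
theorem sum_comp_of_surjective_monoidHom {G H R : Type*} [Group G] [Group H] [Fintype G]
    [Fintype H] [CommSemiring R] (f : G →* H) (hf : Function.Surjective f) (h : H → R) :
    (Fintype.card H : R) * ∑ g, h (f g) = Fintype.card G * ∑ y, h y := by
  have h1 : ∀ y : H, ∑ g, h (f g * y) = ∑ g, h (f g) := fun y => by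
    obtain ⟨g', rfl⟩ := hf y
    exact Fintype.sum_equiv (Equiv.mulRight g') _ _ fun g => by simp
  have h2 : ∀ g : G, ∑ y, h (f g * y) = ∑ y, h y := fun g =>
    Fintype.sum_equiv (Equiv.mulLeft (f g)) _ _ fun y => by simp
  have h3 := Finset.sum_comm (s := (Finset.univ : Finset H)) (t := (Finset.univ : Finset G))
    (f := fun y g => h (f g * y))
  simpa [h1, h2] using h3

theorem sum_comp_of_surjective_addMonoidHom {G H R : Type*} [AddGroup G] [AddGroup H] [Fintype G]
    [Fintype H] [CommSemiring R] (f : G →+ H) (hf : Function.Surjective f) (h : H → R) :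
    (Fintype.card H : R) * ∑ g, h (f g) = Fintype.card G * ∑ y, h y := by
  have h1 : ∀ y : H, ∑ g, h (f g + y) = ∑ g, h (f g) := fun y => by
    obtain ⟨g', rfl⟩ := hf y
    exact Fintype.sum_equiv (Equiv.addRight g') _ _ fun g => by simp
  have h2 : ∀ g : G, ∑ y, h (f g + y) = ∑ y, h y := fun g =>
    Fintype.sum_equiv (Equiv.addLeft (f g)) _ _ fun y => by simp
  have h3 := Finset.sum_comm (s := (Finset.univ : Finset H)) (t := (Finset.univ : Finset G))
    (f := fun y g => h (f g + y))
  simpa [h1, h2] using h3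

/-- The sum of the primitive `n`-th roots of unity is `μ n`. -/
theorem sum_primitiveRoots_eq_moebius {n : ℕ} (hn : 0 < n) :
    ∑ ζ ∈ primitiveRoots n ℂ, ζ = ArithmeticFunction.moebius n := by
  have hsum : ∀ m : ℕ, 0 < m →
      ∑ d ∈ m.divisors, ∑ ζ ∈ primitiveRoots d ℂ, ζ = if m = 1 then (1 : ℂ) else 0 := by
    intro m hm
    have : NeZero m := ⟨hm.ne'⟩
    have hζ := Complex.isPrimitiveRoot_exp m hm.ne'
    rw [← Finset.sum_biUnion fun a _ b _ hab => IsPrimitiveRoot.disjoint hab,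
      ← IsPrimitiveRoot.nthRoots_one_eq_biUnion_primitiveRoots]
    have himg : Polynomial.nthRootsFinset m (1 : ℂ)
        = (Finset.range m).image fun i => Complex.exp (2 * Real.pi * Complex.I / m) ^ i := by
      ext z
      rw [Polynomial.mem_nthRootsFinset hm, Finset.mem_image]
      constructor
      · intro hz
        obtain ⟨i, hi, h⟩ := hζ.eq_pow_of_pow_eq_one hz
        exact ⟨i, Finset.mem_range.2 hi, h⟩
      · rintro ⟨i, -, rfl⟩
        rw [← pow_mul, mul_comm i, pow_mul, hζ.pow_eq_one, one_pow]
    rw [himg, Finset.sum_image fun a ha b hb h =>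
      hζ.pow_inj (Finset.mem_range.1 ha) (Finset.mem_range.1 hb) h]
    split_ifs with h1
    · subst h1; simp
    · exact hζ.geom_sum_eq_zero (by omega)
  -- Möbius inversion of `hsum`; only the pair (n, 1) contributes.
  have h := (ArithmeticFunction.sum_eq_iff_sum_mul_moebius_eq.1 hsum) n hn
  rw [← h, Finset.sum_eq_single (n, 1)]
  · simp
  · rintro ⟨a, b⟩ hab hne
    rw [Nat.mem_divisorsAntidiagonal] at hab
    rw [if_neg, mul_zero]
    rintro rfl
    exact hne (by simpa using hab.1)
  · intro h
    exact absurd (Nat.mem_divisorsAntidiagonal.2 ⟨mul_one n, hn.ne'⟩) h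

theorem sum_units_pow_val_eq_moebius {e : ℕ} [NeZero e] {ζ : ℂ} (hζ : IsPrimitiveRoot ζ e) :
    ∑ u : (ZMod e)ˣ, ζ ^ (u : ZMod e).val = ArithmeticFunction.moebius e := by
  rw [← sum_primitiveRoots_eq_moebius (NeZero.pos e)]
  refine Finset.sum_nbij (fun u : (ZMod e)ˣ => ζ ^ (u : ZMod e).val) ?_ ?_ ?_ fun _ _ => rfl
  · intro u _
    rw [mem_primitiveRoots (NeZero.pos e)]
    exact hζ.pow_of_coprime _ (ZMod.val_coe_unit_coprime u)
  · intro u _ v _ h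
    exact Units.ext (ZMod.val_injective _ (hζ.pow_inj (ZMod.val_lt _) (ZMod.val_lt _) h))
  · intro z hz
    obtain ⟨i, hi, hc, rfl⟩ :=
      hζ.isPrimitiveRoot_iff.1 (isPrimitiveRoot_of_mem_primitiveRoots hz)
    exact ⟨ZMod.unitOfCoprime i hc, by simp, by simp [ZMod.val_cast_of_lt hi]⟩

/-- The power ζ^u depends only on u mod e, so the sum descends along the surjection of unit groups
to a sum of primitive e-th roots of unity. -/
theorem totient_mul_sum_units_pow_val {n e : ℕ} [NeZero n] {ζ : ℂ} (hζ : IsPrimitiveRoot ζ e)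
    (he : e ∣ n) :
    (e.totient : ℂ) * ∑ u : (ZMod n)ˣ, ζ ^ (u : ZMod n).val
      = n.totient * ArithmeticFunction.moebius e := by
  have : NeZero e := ⟨fun h => NeZero.ne n (by simpa [h] using he)⟩
  have h := sum_comp_of_surjective_monoidHom (ZMod.unitsMap he) (ZMod.unitsMap_surjective he)
    fun v : (ZMod e)ˣ => ζ ^ (v : ZMod e).val
  rw [sum_units_pow_val_eq_moebius hζ, ZMod.card_units_eq_totient, ZMod.card_units_eq_totient] at h
  rw [← h]
  congr 1
  refine Finset.sum_congr rfl fun u _ => ?_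
  rw [ZMod.unitsMap_def, Units.coe_map]
  change _ = ζ ^ (ZMod.castHom he (ZMod e) (u : ZMod n)).val
  rw [ZMod.castHom_apply, ZMod.cast_eq_val, ZMod.val_natCast, ← pow_mod_orderOf,
    ← hζ.eq_orderOf]

-- If the order of k divides n, the character factors through `ZMod n` and each unit is hit twice.
-- Otherwise translation by n preserves the indicator but multiplies the sum by ζ^n ≠ 1, forcing it
-- to vanish.
open Classical in
theorem sum_isUnit_cast_mul_stdAddChar {n : ℕ} [NeZero n] (k : ZMod (2 * n)) :
    ∑ i : ZMod (2 * n), (if IsUnit (i.cast : ZMod n) then (1 : ℂ) else 0)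
        * ZMod.stdAddChar (i * k)
      = if addOrderOf k ∣ n then
          2 * (ArithmeticFunction.moebius (addOrderOf k) : ℂ) * n.totient
            / (addOrderOf k).totient
        else 0 := by
  have hdvd : n ∣ 2 * n := Dvd.intro_left 2 rfl
  set ζ : ℂ := ZMod.stdAddChar k with hζdef
  have hpow : ∀ i : ℕ, ζ ^ i = ZMod.stdAddChar ((i : ZMod (2 * n)) * k) := fun i => by
    rw [← nsmul_eq_mul, AddChar.map_nsmul_eq_pow]
  have hζ : IsPrimitiveRoot ζ (addOrderOf k) := by
    refine IsPrimitiveRoot.iff_def _ _ |>.2 ⟨?_, fun l hl => ?_⟩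
    · rw [hpow, ← nsmul_eq_mul, addOrderOf_nsmul_eq_zero, AddChar.map_zero_eq_one]
    · rw [hpow, ← AddChar.map_zero_eq_one (ZMod.stdAddChar (N := 2 * n)),
        ← nsmul_eq_mul] at hl
      exact addOrderOf_dvd_of_nsmul_eq_zero (ZMod.injective_stdAddChar hl)
  have hval : ∀ i : ZMod (2 * n), ZMod.stdAddChar (i * k) = ζ ^ i.val := fun i => by
    rw [hpow, ZMod.natCast_zmod_val]
  split_ifs with he
  · have hφ : ((addOrderOf k).totient : ℂ) ≠ 0 := Nat.cast_ne_zero.2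
      (Nat.totient_pos.2 (addOrderOf_pos k)).ne'
    have h := sum_comp_of_surjective_addMonoidHom (ZMod.castHom hdvd (ZMod n)).toAddMonoidHom
      (ZMod.castHom_surjective hdvd) fun j : ZMod n => if IsUnit j then ζ ^ j.val else 0
    have hunits : ∑ j : ZMod n, (if IsUnit j then ζ ^ j.val else 0)
        = ∑ u : (ZMod n)ˣ, ζ ^ (u : ZMod n).val := by
      rw [← Finset.sum_filter]
      symm
      refine Finset.sum_nbij (fun u : (ZMod n)ˣ => (u : ZMod n)) ?_ ?_ ?_ fun _ _ => rfl
      · intro u _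
        simp
      · intro u _ v _ h
        exact Units.ext h
      · intro j hj
        obtain ⟨u, hu⟩ := (Finset.mem_filter.1 hj).2
        exact ⟨u, by simp, hu⟩
    have hL : ∑ i : ZMod (2 * n), (if IsUnit (i.cast : ZMod n) then (1 : ℂ) else 0)
        * ZMod.stdAddChar (i * k) = 2 * ∑ u : (ZMod n)ˣ, ζ ^ (u : ZMod n).val := by
      rw [hunits, ZMod.card, ZMod.card] at h
      have hn0 : (n : ℂ) ≠ 0 := Nat.cast_ne_zero.2 (NeZero.ne n)
      refine mul_left_cancel₀ hn0 ?_
      rw [← mul_assoc, mul_comm (n : ℂ) 2, show (2 : ℂ) * n = ((2 * n : ℕ) : ℂ) by push_cast; rfl,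
        ← h]
      congr 1
      refine Finset.sum_congr rfl fun i _ => ?_
      have hi : (ZMod.castHom hdvd (ZMod n)).toAddMonoidHom i = (i.cast : ZMod n) := rfl
      rw [hi, hval, ite_mul, one_mul, zero_mul]
      congr 1
      rw [ZMod.cast_eq_val, ZMod.val_natCast]
      conv_lhs => rw [← pow_mod_orderOf, ← hζ.eq_orderOf, ← Nat.mod_mod_of_dvd _ he]
      conv_rhs => rw [← pow_mod_orderOf, ← hζ.eq_orderOf]
    rw [hL, eq_div_iff hφ, mul_assoc, mul_comm _ ((addOrderOf k).totient : ℂ),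
      totient_mul_sum_units_pow_val hζ he]
    ring
  · have hne : ζ ^ n ≠ 1 := fun h => he (hζ.dvd_of_pow_eq_one n h)
    set S := ∑ i : ZMod (2 * n), (if IsUnit (i.cast : ZMod n) then (1 : ℂ) else 0)
        * ZMod.stdAddChar (i * k) with hS
    have hSS : ζ ^ n * S = S := by
      rw [hS, Finset.mul_sum]
      refine Fintype.sum_equiv (Equiv.addRight (n : ZMod (2 * n))) _ _ fun i => ?_
      have hc : ((i + (n : ZMod (2 * n))).cast : ZMod n) = i.cast := by
        rw [ZMod.cast_add hdvd, ZMod.cast_natCast hdvd, ZMod.natCast_self, add_zero]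
      rw [Equiv.coe_addRight, hc, mul_left_comm, hpow, ← AddChar.map_add_eq_mul, ← add_mul,
        add_comm (n : ZMod (2 * n))]
    have : (ζ ^ n - 1) * S = 0 := by rw [sub_mul, hSS, one_mul, sub_self]
    exact (mul_eq_zero.1 this).resolve_left (sub_ne_zero.2 hne)

/-! ### Generating pairs of the dicyclic group -/

namespace QuaternionGroup

variable {n : ℕ}

/-- The subgroup of `QuaternionGroup n` made of the `a k` with `k ∈ K` and the `xa k` with
`k - c ∈ K`. -/
def dicyclicSubgroup (K : AddSubgroup (ZMod (2 * n))) (hK : (n : ZMod (2 * n)) ∈ K)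
    (c : ZMod (2 * n)) : Subgroup (QuaternionGroup n) where
  carrier := {g | match g with
    | a k => k ∈ K
    | xa k => k - c ∈ K}
  one_mem' := K.zero_mem
  mul_mem' := by
    rintro (k | k) (l | l) hk hl
    · exact K.add_mem hk hl
    · change l - k - c ∈ K
      rw [sub_right_comm]
      exact K.sub_mem hl hk
    · change k + l - c ∈ K
      rw [add_sub_right_comm]
      exact K.add_mem hk hl
    · change (n : ZMod (2 * n)) + l - k ∈ K
      rw [show (n : ZMod (2 * n)) + l - k = n + ((l - c) - (k - c)) by ring]
      exact K.add_mem hK (K.sub_mem hl hk)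
  inv_mem' := by
    rintro (k | k) hk
    · exact K.neg_mem hk
    · change (n : ZMod (2 * n)) + k - c ∈ K
      rw [add_sub_assoc]
      exact K.add_mem hK hk

/-- Since (xa j)² = a n, the exponent i matters only mod n. If i mod n generates a proper subgroup
of `ZMod n`, its preimage yields a proper `dicyclicSubgroup` containing both elements. -/
theorem closure_a_xa_eq_top_iff [NeZero n] (i j : ZMod (2 * n)) :
    Subgroup.closure {a i, xa j} = ⊤ ↔ IsUnit (i.cast : ZMod n) := by
  have hdvd : n ∣ 2 * n := Dvd.intro_left 2 rfl
  have hcast : ∀ k : ZMod (2 * n), ZMod.castHom hdvd (ZMod n) k = k.cast := fun _ => rfl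
  constructor
  · intro h
    let K : AddSubgroup (ZMod (2 * n)) := (AddSubgroup.zmultiples (i.cast : ZMod n)).comap
      (ZMod.castHom hdvd (ZMod n)).toAddMonoidHom
    have hK : (n : ZMod (2 * n)) ∈ K := by
      refine AddSubgroup.mem_comap.2 ?_
      change ZMod.castHom hdvd (ZMod n) (n : ZMod (2 * n)) ∈ _
      rw [map_natCast, ZMod.natCast_self]
      exact AddSubgroup.zero_mem _
    have hle : Subgroup.closure {a i, xa j} ≤ dicyclicSubgroup K hK j := by
      rw [Subgroup.closure_le]
      rintro g (rfl | rfl)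
      · exact AddSubgroup.mem_zmultiples _
      · change j - j ∈ K
        rw [sub_self]
        exact K.zero_mem
    rw [h] at hle
    have h1 : (1 : ZMod (2 * n)) ∈ K := hle (Subgroup.mem_top (a 1))
    have h2 : ZMod.castHom hdvd (ZMod n) 1 ∈ AddSubgroup.zmultiples (i.cast : ZMod n) := h1
    rw [map_one] at h2
    obtain ⟨m, hm⟩ := AddSubgroup.mem_zmultiples_iff.1 h2
    rw [zsmul_eq_mul, mul_comm] at hm
    exact IsUnit.of_mul_eq_one _ hm
  · intro h
    set H := Subgroup.closure {a i, xa j}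
    have hi : a i ∈ H := Subgroup.subset_closure (by simp)
    have hj : xa j ∈ H := Subgroup.subset_closure (by simp)
    have hn : a (n : ZMod (2 * n)) ∈ H := by
      have h := H.mul_mem hj hj
      rwa [xa_mul_xa, add_sub_cancel_right] at h
    have hsmul : ∀ (k : ZMod (2 * n)) (m : ℕ), a k ∈ H → a ((m : ZMod (2 * n)) * k) ∈ H := by
      intro k m hk
      induction m with
      | zero => simp
      | succ m ih =>
        have := H.mul_mem ih hk
        rw [a_mul_a] at this
        convert this using 2
        push_cast
        ring
    have hmul : ∀ k m : ZMod (2 * n), a k ∈ H → a (m * k) ∈ H := fun k m hk => by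
      have := hsmul k m.val hk
      rwa [ZMod.natCast_zmod_val] at this
    obtain ⟨v, hv⟩ := h.exists_left_inv
    obtain ⟨w, rfl⟩ := ZMod.castHom_surjective hdvd v
    -- With w lifting an inverse of i mod n, 1 = w·i + t·n, so `a 1` is a product of powers of `a i`
    -- and `a n`.
    have hker : ((1 - w * i).val : ZMod n) = 0 := by
      rw [← ZMod.cast_eq_val, ← hcast, map_sub, map_mul, map_one, hcast i, hv, sub_self]
    obtain ⟨t, ht⟩ := (ZMod.natCast_eq_zero_iff _ _).1 hker
    have h1 : a (1 : ZMod (2 * n)) ∈ H := by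
      have := H.mul_mem (hmul i w hi) (hmul n t hn)
      rw [a_mul_a] at this
      convert this using 2
      have h3 := congrArg (Nat.cast (R := ZMod (2 * n))) ht
      rw [ZMod.natCast_zmod_val, Nat.cast_mul] at h3
      linear_combination h3
    have ha : ∀ k : ZMod (2 * n), a k ∈ H := fun k => by simpa using hmul 1 k h1
    rw [eq_top_iff]
    rintro (k | k) -
    · exact ha k
    · have := H.mul_mem hj (ha (k - j))
      rwa [xa_mul_a, add_sub_cancel] at this

/-- The product `xa i * xa j` is `a (n + j - i)`, so it can replace `xa i` as a generator; its
exponent is -(i - j) mod n. -/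
theorem closure_xa_xa_eq_top_iff [NeZero n] (i j : ZMod (2 * n)) :
    Subgroup.closure {xa i, xa j} = ⊤ ↔ IsUnit ((i - j).cast : ZMod n) := by
  have hdvd : n ∣ 2 * n := Dvd.intro_left 2 rfl
  have hcl : Subgroup.closure {xa i, xa j}
      = Subgroup.closure {a ((n : ZMod (2 * n)) + j - i), xa j} := by
    apply le_antisymm <;> rw [Subgroup.closure_le]
    · have hj : xa j ∈ Subgroup.closure {a ((n : ZMod (2 * n)) + j - i), xa j} :=
        Subgroup.subset_closure (by simp)
      rintro g (rfl | rfl)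
      · have h := Subgroup.mul_mem _ (Subgroup.subset_closure 
          (k := {a ((n : ZMod (2 * n)) + j - i), xa j})
          (Set.mem_insert _ _)) (Subgroup.inv_mem _ hj)
        rwa [← xa_mul_xa, mul_inv_cancel_right] at h
      · exact hj
    · have hi : xa i ∈ Subgroup.closure {xa i, xa j} := Subgroup.subset_closure (by simp)
      have hj : xa j ∈ Subgroup.closure {xa i, xa j} := Subgroup.subset_closure (by simp)
      rintro g (rfl | rfl)
      · rw [← xa_mul_xa]
        exact Subgroup.mul_mem _ hi hj
      · exact hj
  have hc : ((n : ZMod (2 * n)) + j - i).cast = -((i - j).cast : ZMod n) := by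
    rw [← ZMod.cast_neg hdvd, neg_sub, add_sub_assoc, ZMod.cast_add hdvd, ZMod.cast_natCast hdvd,
      ZMod.natCast_self, zero_add]
  rw [hcl, closure_a_xa_eq_top_iff, hc, IsUnit.neg_iff]

theorem closure_a_a_ne_top [NeZero n] (i j : ZMod (2 * n)) : Subgroup.closure {a i, a j} ≠ ⊤ := by
  intro h
  have hle : Subgroup.closure {a i, a j} ≤ Subgroup.zpowers (a 1) := by
    rw [Subgroup.closure_le]
    have ha : ∀ k : ZMod (2 * n), a k ∈ Subgroup.zpowers (a (1 : ZMod (2 * n))) := fun k => by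
      exact Subgroup.mem_zpowers_iff.2 ⟨k.val, by
        rw [zpow_natCast, a_one_pow, ZMod.natCast_zmod_val]⟩
    rintro g (rfl | rfl)
    · exact ha i
    · exact ha j
  rw [h] at hle
  obtain ⟨m, hm⟩ := mem_powers_iff_mem_zpowers.2 (hle (Subgroup.mem_top (xa 0)))
  simp at hm

/-- `QuaternionGroup n` is the disjoint union of the cyclic subgroup of the `a i` and the coset of
the `xa i`. -/
def sumEquiv (n : ℕ) : ZMod (2 * n) ⊕ ZMod (2 * n) ≃ QuaternionGroup n where
  toFun := Sum.elim a xa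
  invFun g := match g with
    | a i => Sum.inl i
    | xa i => Sum.inr i
  left_inv := by rintro (i | i) <;> rfl
  right_inv := by rintro (i | i) <;> rfl

end QuaternionGroup

open QuaternionGroup

/-! ### The adjacency matrix in block form -/

theorem generatingGraph_not_adj_a_a {n : ℕ} [NeZero n] (i j : ZMod (2 * n)) :
    ¬ (generatingGraph (QuaternionGroup n)).Adj (a i) (a j) :=
  fun h => closure_a_a_ne_top i j h.2

theorem generatingGraph_adj_a_xa {n : ℕ} [NeZero n] (i j : ZMod (2 * n)) :
    (generatingGraph (QuaternionGroup n)).Adj (a i) (xa j) ↔ IsUnit (i.cast : ZMod n) := by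
  rw [← closure_a_xa_eq_top_iff i j]
  exact ⟨fun h => h.2, fun h => ⟨by simp, h⟩⟩

/-- As n ≥ 2, zero is not a unit mod n; the circulant block therefore has zero diagonal, matching
the absence of loops. -/
theorem generatingGraph_adj_xa_xa {n : ℕ} [NeZero n] (hn : 2 ≤ n) (i j : ZMod (2 * n)) :
    (generatingGraph (QuaternionGroup n)).Adj (xa i) (xa j)
      ↔ IsUnit ((i - j).cast : ZMod n) := by
  have : Fact (1 < n) := ⟨hn⟩
  rw [← closure_xa_xa_eq_top_iff i j]
  refine ⟨fun h => h.2, fun h => ⟨?_, h⟩⟩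
  intro hij
  rw [closure_xa_xa_eq_top_iff, xa.inj hij, sub_self, ZMod.cast_zero] at h
  exact not_isUnit_zero h

open Classical in
theorem adjMatrix_generatingGraph_reindex {n : ℕ} [NeZero n] (hn : 2 ≤ n)
    [DecidableRel (generatingGraph (QuaternionGroup n)).Adj] (f : ZMod (2 * n) → ℂ)
    (hf : ∀ i, f i = if IsUnit (i.cast : ZMod n) then 1 else 0) :
    Matrix.reindex (sumEquiv n).symm (sumEquiv n).symm
      (((generatingGraph (QuaternionGroup n)).adjMatrix ℝ).map (algebraMap ℝ ℂ)) =
    Matrix.fromBlocks 0 (Matrix.of fun i _ => f i) (Matrix.of fun _ j => f j)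
      (Matrix.circulant f) := by
  ext (i | i) (j | j)
  · simp [sumEquiv, SimpleGraph.adjMatrix_apply, generatingGraph_not_adj_a_a]
  · simp [sumEquiv, SimpleGraph.adjMatrix_apply, generatingGraph_adj_a_xa, hf,
      apply_ite Complex.ofReal]
  · simp [sumEquiv, SimpleGraph.adjMatrix_apply, SimpleGraph.adj_comm _ (xa i),
      generatingGraph_adj_a_xa, hf, apply_ite Complex.ofReal]
  · simp [sumEquiv, SimpleGraph.adjMatrix_apply, generatingGraph_adj_xa_xa hn, hf,
      apply_ite Complex.ofReal]

/-! ### Counting eigenvalues by additive order -/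

theorem squarefreePart_dvd (n : ℕ) : squarefreePart n ∣ n := Nat.prod_primeFactors_dvd n

theorem dvd_squarefreePart_of_squarefree {d n : ℕ} (hn : n ≠ 0) (hd : Squarefree d) (h : d ∣ n) :
    d ∣ squarefreePart n := by
  rw [← Nat.prod_primeFactors_of_squarefree hd]
  exact Finset.prod_dvd_prod_of_subset _ _ _ (Nat.primeFactors_mono h hn)

/-- A cyclic group of order N has φ(d) elements of each order d dividing N. -/
theorem map_addOrderOf_zmod_erase_zero {N : ℕ} [NeZero N] {R : Type*} (v : ℕ → R) :
    ((Finset.univ : Finset (ZMod N)).erase 0).val.map (fun k => v (addOrderOf k))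
      = ∑ d ∈ N.divisors.erase 1, Multiset.replicate d.totient (v d) := by
  have hmaps : ∀ k ∈ (Finset.univ : Finset (ZMod N)).erase 0,
      addOrderOf k ∈ N.divisors.erase 1 := fun k hk => by
    rw [Finset.mem_erase, Nat.mem_divisors]
    refine ⟨fun h => Finset.ne_of_mem_erase hk (AddMonoid.addOrderOf_eq_one_iff.1 h), ?_,
      NeZero.ne N⟩
    simpa using addOrderOf_dvd_card (x := k)
  have h1 : ((Finset.univ : Finset (ZMod N)).erase 0).val.map (fun k => v (addOrderOf k))
      = ∑ k ∈ (Finset.univ : Finset (ZMod N)).erase 0, {v (addOrderOf k)} := by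
    rw [← Multiset.sum_map_singleton (Multiset.map _ _), Multiset.map_map]
    rfl
  rw [h1, ← Finset.sum_fiberwise_of_maps_to' hmaps fun d => ({v d} : Multiset R)]
  refine Finset.sum_congr rfl fun d hd => ?_
  rw [Finset.mem_erase, Nat.mem_divisors] at hd
  have hfilter : ((Finset.univ : Finset (ZMod N)).erase 0).filter (fun k => addOrderOf k = d)
      = Finset.univ.filter fun k => addOrderOf k = d := by
    ext k
    simp only [Finset.mem_filter, Finset.mem_erase, Finset.mem_univ, and_true, true_and,
      and_iff_right_iff_imp]
    rintro rfl rfl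
    exact hd.1 addOrderOf_zero
  rw [hfilter, Finset.sum_const, IsAddCyclic.card_addOrderOf_eq_totient
    (by rw [ZMod.card]; exact hd.2.1), Multiset.nsmul_singleton]

/-- The sum of an additive character of order `d` of `ZMod (2 * n)` over the residues coprime to `n`. -/
noncomputable def dicyclicEigenvalue (n d : ℕ) : ℝ :=
  if d ∣ n then 2 * (ArithmeticFunction.moebius d : ℝ) * n.totient / d.totient else 0

/-- A divisor of 2n not dividing n₀ either fails to divide n or is not squarefree, so its eigenvalue
is 0. By ∑ φ(d) = m over d ∣ m, these zeros number (2n - 1) - (n₀ - 1). -/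
theorem sum_replicate_dicyclicEigenvalue {n : ℕ} [NeZero n] :
    ∑ d ∈ (2 * n).divisors.erase 1, Multiset.replicate d.totient (dicyclicEigenvalue n d)
      = Multiset.replicate (2 * n - squarefreePart n) 0
        + ∑ d ∈ (squarefreePart n).divisors.erase 1, Multiset.replicate d.totient
          (2 * (ArithmeticFunction.moebius d : ℝ) * n.totient / d.totient) := by
  have hn : n ≠ 0 := NeZero.ne n
  have hdvd := squarefreePart_dvd n
  have hsub : (squarefreePart n).divisors.erase 1 ⊆ (2 * n).divisors.erase 1 :=
    Finset.erase_subset_erase _ (Nat.divisors_subset_of_dvd (by omega) (hdvd.mul_left 2))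
  rw [← Finset.sum_sdiff hsub]
  have hcard : ∀ m : ℕ, m ≠ 0 → ∑ d ∈ m.divisors.erase 1, d.totient + 1 = m := fun m hm => by
    have := Finset.sum_erase_add m.divisors Nat.totient (Nat.one_mem_divisors.2 hm)
    rwa [Nat.totient_one, Nat.sum_totient] at this
  congr 1
  · rw [Multiset.eq_replicate]
    constructor
    · have h1 := hcard (2 * n) (by omega)
      have h2 := hcard (squarefreePart n) (ne_zero_of_dvd_ne_zero hn hdvd)
      rw [← Finset.sum_sdiff hsub] at h1
      simp only [Multiset.card_sum, Multiset.card_replicate]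
      omega
    · intro b hb
      obtain ⟨d, hd, hb⟩ := Multiset.mem_sum.1 hb
      rw [Multiset.eq_of_mem_replicate hb, dicyclicEigenvalue]
      split_ifs with h
      · rw [Finset.mem_sdiff, Finset.mem_erase, Finset.mem_erase, Nat.mem_divisors,
          Nat.mem_divisors] at hd
        rw [ArithmeticFunction.moebius_eq_zero_of_not_squarefree]
        · simp
        · exact fun hsq => hd.2 ⟨hd.1.1, dvd_squarefreePart_of_squarefree hn hsq h,
            ne_zero_of_dvd_ne_zero hn hdvd⟩
      · rfl
  · refine Finset.sum_congr rfl fun d hd => ?_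
    rw [dicyclicEigenvalue,
      if_pos ((Nat.dvd_of_mem_divisors (Finset.mem_of_mem_erase hd)).trans hdvd)]

/-! ### The spectrum -/

open Polynomial in
theorem charpoly_adjMatrix_generatingGraph {n : ℕ} [NeZero n] (hn : 2 ≤ n)
    [DecidableRel (generatingGraph (QuaternionGroup n)).Adj] :
    ((generatingGraph (QuaternionGroup n)).adjMatrix ℝ).charpoly =
      X ^ (2 * n - 1) * (X ^ 2 - C (2 * (n.totient : ℝ)) * X - C (4 * (n : ℝ) * n.totient))
        * ∏ k ∈ (Finset.univ : Finset (ZMod (2 * n))).erase 0,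
          (X - C (dicyclicEigenvalue n (addOrderOf k))) := by
  classical
  let f : ZMod (2 * n) → ℂ := fun i => if IsUnit (i.cast : ZMod n) then 1 else 0
  have hhat : ∀ k, ∑ i, f i * ZMod.stdAddChar (i * k)
      = ((dicyclicEigenvalue n (addOrderOf k) : ℝ) : ℂ) := fun k => by
    rw [sum_isUnit_cast_mul_stdAddChar, dicyclicEigenvalue]
    split_ifs <;> push_cast <;> rfl
  -- The transform at k = 0, an element of order 1.
  have hsum : ∑ i, f i = 2 * n.totient := by
    have := hhat 0
    simpa [dicyclicEigenvalue] using this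
  have hsq : ∑ i, f i ^ 2 = ∑ i, f i :=
    Finset.sum_congr rfl fun i _ => by simp only [f]; split_ifs <;> simp
  apply Polynomial.map_injective (algebraMap ℝ ℂ) (algebraMap ℝ ℂ).injective
  rw [← Matrix.charpoly_map, ← Matrix.charpoly_reindex (QuaternionGroup.sumEquiv n).symm,
    adjMatrix_generatingGraph_reindex hn f fun _ => rfl, charpoly_fromBlocks_circulant]
  simp only [hhat, hsq, hsum, Polynomial.map_mul, Polynomial.map_pow, Polynomial.map_sub,
    Polynomial.map_X, Polynomial.map_C, Polynomial.map_prod]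
  congr 4
  · simp
  · push_cast
    ring

theorem mainTheorem1 (n : ℕ) [NeZero n] (hn : 2 ≤ n)
    [DecidableRel (generatingGraph (QuaternionGroup n)).Adj] :
    adjacencySpectrum (generatingGraph (QuaternionGroup n)) =
      Multiset.replicate (4 * n - (squarefreePart n + 1)) (0 : ℝ)
      + ∑ d ∈ (squarefreePart n).divisors.erase 1,
          Multiset.replicate (Nat.totient d)
            (2 * (ArithmeticFunction.moebius d : ℝ) * (Nat.totient n : ℝ) / (Nat.totient d : ℝ))
      + {(Nat.totient n : ℝ) +
            √((Nat.totient n : ℝ) ^ 2 + 4 * (n : ℝ) * (Nat.totient n : ℝ))}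
      + {(Nat.totient n : ℝ) -
            √((Nat.totient n : ℝ) ^ 2 + 4 * (n : ℝ) * (Nat.totient n : ℝ))} := by
  have hle : squarefreePart n ≤ n := Nat.le_of_dvd (by omega) (squarefreePart_dvd n)
  set r := √((Nat.totient n : ℝ) ^ 2 + 4 * (n : ℝ) * (Nat.totient n : ℝ)) with hr
  have hr2 : r ^ 2 = (Nat.totient n : ℝ) ^ 2 + 4 * (n : ℝ) * (Nat.totient n : ℝ) :=
    Real.sq_sqrt (by positivity)
  -- The zeros split into 2n - 1 from the power of X and 2n - n₀ from nontrivial characters. The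
  -- claimed multiset then becomes the roots of a product of linear factors, leaving an identity of
  -- polynomials.
  rw [show 4 * n - (squarefreePart n + 1) = (2 * n - 1) + (2 * n - squarefreePart n) by omega,
    Multiset.replicate_add, add_assoc (Multiset.replicate (2 * n - 1) (0 : ℝ)),
    ← sum_replicate_dicyclicEigenvalue, ← map_addOrderOf_zmod_erase_zero, adjacencySpectrum,
    ← Polynomial.roots_multiset_prod_X_sub_C (_ + _)]
  congr 1
  rw [charpoly_adjMatrix_generatingGraph hn]
  have hquad : (Polynomial.X ^ 2 - Polynomial.C (2 * (n.totient : ℝ)) * Polynomial.X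
      - Polynomial.C (4 * (n : ℝ) * n.totient))
      = (Polynomial.X - Polynomial.C (n.totient + r)) * (Polynomial.X - Polynomial.C (n.totient - r))
      := by
    rw [show 4 * (n : ℝ) * n.totient = r ^ 2 - n.totient ^ 2 by rw [hr2]; ring]
    simp only [map_add, map_sub, map_mul, map_pow, map_ofNat]
    ring
  rw [hquad]
  simp only [Multiset.map_add, Multiset.prod_add, Multiset.map_replicate, Multiset.prod_replicate,
    Multiset.map_map, Multiset.map_singleton, Multiset.prod_singleton, Polynomial.C_0, sub_zero]
  rw [Finset.prod_eq_multiset_prod]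
  simp only [Function.comp_def]
  ring
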